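/- Let $\mathcal H$ be a complex Hilbert space, $\mathcal M\subseteq\mathcal B(\mathcal H)$ a von Neumann algebra with $\dim\mathcal M>1$, and $\mathcal I$ a two-sided ideal of $\mathcal M$ (not assumed to be norm closed) that is dense in $\mathcal M$ in the weak-operator topology. Let $\Phi$ be a norm on $\mathcal I$ that is unitarily invariant, i.e. $\Phi(UXV)=\Phi(X)$ for all $X\in\mathcal I$ and all unitary operators $U,V\in\mathcal M$, and $\|\cdot\|$-dominating, i.e. $\Phi(X)\ge\|X\|$ for all $X\in\mathcal I$, where $\|\cdot\|$ is the operator norm. Let $\mathcal P(\mathcal M)$ be the set of projections (self-adjoint idempotents) in $\mathcal M$. Then the following two statements are equivalent. (a) $\displaystyle c_\Phi:=\sup_{0\ne P\in\mathcal P(\mathcal M)}\ \inf\{\Phi(E): E\in\mathcal I\cap\mathcal P(\mathcal M),\ 0\ne E\le P\}<\infty$. (b) For every $T\in\mathcal M$ and every $\varepsilon>0$ there exists an operator $X\in\mathcal I$ with $\Phi(X)<\varepsilon$ such that the spectrum $\sigma(T+X)$ is disconnected. -/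

import Mathlib

open scoped ENNReal

noncomputable section

namespace SupInf

variable {H : Type*} [NormedAddCommGroup H] [InnerProductSpace ℂ H] [CompleteSpace H]

/-- `I` is a (two-sided, not necessarily norm closed) ideal of the von Neumann algebra `M`:
a linear subspace of `M` that absorbs multiplication by elements of `M` from both sides. -/
structure IsTwoSidedIdeal (M : VonNeumannAlgebra H) (I : Submodule ℂ (H →L[ℂ] H)) : Prop where
  subset : ∀ X ∈ I, X ∈ M
  mul_mem_left : ∀ A ∈ M, ∀ X ∈ I, A * X ∈ I
  mul_mem_right : ∀ A ∈ M, ∀ X ∈ I, X * A ∈ I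

/-- `I` is dense in `M` for the weak-operator topology. -/
def IsWeakOperatorDense (M : VonNeumannAlgebra H) (I : Submodule ℂ (H →L[ℂ] H)) : Prop :=
  ∀ T ∈ M, ContinuousLinearMapWOT.ofCLM T ∈
    closure (ContinuousLinearMapWOT.ofCLM '' (I : Set (H →L[ℂ] H)))

/-- A seminorm is a norm if it vanishes only at `0`. -/
def IsNorm {I : Submodule ℂ (H →L[ℂ] H)} (Φ : Seminorm ℂ I) : Prop :=
  ∀ X : I, Φ X = 0 → X = 0

/-- `Φ (U X V) = Φ X` for all `X` in the ideal `I` and all unitary operators `U`, `V` in `M`. -/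
def IsUnitarilyInvariant {M : VonNeumannAlgebra H} {I : Submodule ℂ (H →L[ℂ] H)}
    (hI : IsTwoSidedIdeal M I) (Φ : Seminorm ℂ I) : Prop :=
  ∀ (U V : H →L[ℂ] H) (hU : U ∈ M) (hV : V ∈ M),
    U ∈ unitary (H →L[ℂ] H) → V ∈ unitary (H →L[ℂ] H) → ∀ X : I,
      Φ ⟨U * (X : H →L[ℂ] H) * V,
        hI.mul_mem_right V hV _ (hI.mul_mem_left U hU _ X.2)⟩ = Φ X

/-- `Φ X ≥ ‖X‖` (the operator norm) for all `X` in the ideal. -/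
def IsNormDominating {I : Submodule ℂ (H →L[ℂ] H)} (Φ : Seminorm ℂ I) : Prop :=
  ∀ X : I, ‖(X : H →L[ℂ] H)‖ ≤ Φ X

/-- The infimum of `Φ E` over the nonzero projections `E ≤ P` in the ideal. -/
def fPhi {I : Submodule ℂ (H →L[ℂ] H)} (Φ : Seminorm ℂ I) (P : H →L[ℂ] H) : ℝ≥0∞ :=
  ⨅ E : {E : I // IsStarProjection (E : H →L[ℂ] H) ∧ E ≠ 0 ∧ (E : H →L[ℂ] H) ≤ P},
    ENNReal.ofReal (Φ E)

/-- The supremum in `[0, ∞]` of `fPhi Φ P` over the nonzero projections `P` in `M`. -/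
def cPhi (M : VonNeumannAlgebra H) {I : Submodule ℂ (H →L[ℂ] H)} (Φ : Seminorm ℂ I) : ℝ≥0∞ :=
  ⨆ P : {P : H →L[ℂ] H // P ∈ M ∧ IsStarProjection P ∧ P ≠ 0}, fPhi Φ P

end SupInf

end

/-! Suppose `cPhi` is finite. Let z be a point of σ(T) with largest real part, R = T - z, and μ = z
+ s with s > 0 small, so that T - μ is invertible. Since z is a limit of resolvent points, R is not
bounded below, and a spectral projection P of R*R satisfies ‖RP‖ ≤ δ. Finiteness of `cPhi` gives a
nonzero projection E ≤ P in the ideal with Φ(E) bounded independently of δ. Then G = T - μ - RE is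
still invertible and GE = -sE. With X = sE - RE, which is small in Φ, one gets T + X - μ = G(1 - E).
For this operator 0 is an isolated, but not the only, spectral point
(`not_isPreconnected_spectrum_mul`).

Suppose instead that `cPhi` is infinite. Let L(t) be the closed span of the ranges of the ideal
projections with Φ < t. Unitary invariance makes the projection onto L(t) central. Each L(t) is
proper because `cPhi` is infinite, while weak-operator density makes the union of the L(n) dense.
Hence infinitely many jumps produce nonzero central blocks W_k. An X in the ideal vanishing on L(t)
satisfies t‖X‖ ≤ 4Φ(X), so if Φ(X) is small then ‖X W_k‖ ≤ 1/(k+1). Let T be the scalar q_k on W_k,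
where |q_k| ≤ 1 - 1/(k+1) and the q_k return near every point of the open unit disc infinitely
often. Then ‖T + X‖ ≤ 1 and every point of the open disc lies in σ(T + X). This spectrum lies
between the open disc and its closure, so it is connected for every such X. -/

noncomputable section

namespace SupInf

open Filter Topology ContinuousLinearMap

/-! ### Isolated spectral points in a Banach algebra. -/

section Banach

variable {A : Type*} [NormedRing A] [NormedAlgebra ℂ A] [CompleteSpace A]

/-- If the spectrum of `a` is `{0}`, then `‖a ^ n‖ < r ^ n` for some `n`, for any `r > 0`. -/
lemma exists_norm_pow_lt {a : A} (h : ∀ z ∈ spectrum ℂ a, z = 0) {r : ℝ} (hr : 0 < r) :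
    ∃ n : ℕ, ‖a ^ n‖ < r ^ n := by
  have h0 : spectralRadius ℂ a = 0 := by
    rw [spectralRadius]
    simp only [ENNReal.iSup_eq_zero]
    intro z hz
    simp [h z hz]
  have ht := spectrum.pow_norm_pow_one_div_tendsto_nhds_spectralRadius a
  rw [h0] at ht
  have h1 : ∀ᶠ n : ℕ in atTop, ENNReal.ofReal (‖a ^ n‖ ^ (1 / n : ℝ)) < ENNReal.ofReal r :=
    ht.eventually_lt_const (ENNReal.ofReal_pos.2 hr)
  obtain ⟨n, hn, hn0⟩ := (h1.and (eventually_gt_atTop 0)).exists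
  refine ⟨n, ?_⟩
  rw [ENNReal.ofReal_lt_ofReal_iff hr] at hn
  have hn' : (n : ℝ) ≠ 0 := by positivity
  have := Real.rpow_lt_rpow (by positivity) hn (by positivity : (0 : ℝ) < n)
  rwa [← Real.rpow_mul (norm_nonneg _), one_div_mul_cancel hn', Real.rpow_one,
    Real.rpow_natCast] at this

/-- If `G` is invertible and acts on the range of a nontrivial idempotent `E` as a nonzero scalar,
then the spectrum of `G * (1 - E)` is disconnected. -/
lemma not_isPreconnected_spectrum_mul {G E : A} (hG : IsUnit G) (hE : E * E = E) (hE0 : E ≠ 0)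
    (hE1 : E ≠ 1) {s : ℂ} (hs : s ≠ 0) (hGE : G * E = s • E) :
    ¬ IsPreconnected (spectrum ℂ (G * (1 - E))) := by
  set D := G * (1 - E) with hD
  have hFE : (1 - E) * E = 0 := by rw [sub_mul, one_mul, hE, sub_self]
  have hEF : E * (1 - E) = 0 := by rw [mul_sub, mul_one, hE, sub_self]
  have hDE : D * E = 0 := by rw [hD, mul_assoc, hFE, mul_zero]
  have hzero : (0 : ℂ) ∈ spectrum ℂ D := by
    rw [spectrum.zero_mem_iff]
    intro hu
    exact hE0 (hu.mul_right_eq_zero.1 hDE)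
  obtain ⟨w, hw, hw0⟩ : ∃ w ∈ spectrum ℂ D, w ≠ 0 := by
    -- G preserves the range of E, so (1 - E)Dⁿ = (1 - E)Gⁿ for all n. If D were quasinilpotent,
    -- some ‖Dⁿ‖ would be less than ‖G⁻¹‖⁻ⁿ, and 1 - E = (1 - E)DⁿG⁻ⁿ would force 1 - E = 0.
    by_contra! hcon
    obtain ⟨u, rfl⟩ := hG
    have hFG : ∀ n : ℕ, (1 - E) * (u : A) ^ n * E = 0 := by
      intro n
      induction n with
      | zero => simpa using hFE
      | succ n ih => rw [pow_succ, ← mul_assoc, mul_assoc _ (u : A) E, hGE, mul_smul_comm, ih,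
          smul_zero]
    have hFD : ∀ n : ℕ, (1 - E) * D ^ n = (1 - E) * (u : A) ^ n := by
      intro n
      induction n with
      | zero => simp
      | succ n ih =>
        rw [pow_succ, ← mul_assoc, ih, hD, mul_assoc, ← mul_assoc (_ ^ n), ← pow_succ, mul_sub,
          mul_one, mul_sub, ← mul_assoc, hFG, sub_zero]
    have hne : 1 - E ≠ 0 := sub_ne_zero.2 hE1.symm
    have : Nontrivial A := ⟨⟨_, _, hE0⟩⟩
    have hK : 0 < ‖(↑u⁻¹ : A)‖ := norm_pos_iff.2 (Units.ne_zero _)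
    obtain ⟨n, hn⟩ := exists_norm_pow_lt hcon (inv_pos.2 hK)
    have h1 : 1 - E = (1 - E) * D ^ n * (↑u⁻¹ : A) ^ n := by
      rw [hFD, mul_assoc, ← Units.val_pow_eq_pow_val, ← Units.val_pow_eq_pow_val, inv_pow,
        Units.mul_inv, mul_one]
    have h2 : ‖1 - E‖ ≤ ‖1 - E‖ * ‖D ^ n‖ * ‖(↑u⁻¹ : A)‖ ^ n := by
      rcases n.eq_zero_or_pos with rfl | hnp
      · simp only [pow_zero] at hn
        exact absurd hn (not_lt.2 (one_le_norm_one A))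
      calc ‖1 - E‖ = ‖(1 - E) * D ^ n * (↑u⁻¹ : A) ^ n‖ := by rw [← h1]
        _ ≤ ‖(1 - E) * D ^ n‖ * ‖(↑u⁻¹ : A) ^ n‖ := norm_mul_le _ _
        _ ≤ ‖1 - E‖ * ‖D ^ n‖ * ‖(↑u⁻¹ : A)‖ ^ n :=
          mul_le_mul (norm_mul_le _ _) (norm_pow_le' _ hnp) (norm_nonneg _) (by positivity)
    have h3 : ‖D ^ n‖ * ‖(↑u⁻¹ : A)‖ ^ n < 1 := by
      rw [inv_pow] at hn
      rwa [← one_div, lt_div_iff₀ (pow_pos hK n)] at hn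
    have h4 : 0 < ‖1 - E‖ := norm_pos_iff.2 hne
    nlinarith
  have hiso : ∀ᶠ z in 𝓝 (0 : ℂ), z ∈ spectrum ℂ D → z = 0 := by
    have h1 : ∀ᶠ z : ℂ in 𝓝 0, IsUnit (algebraMap ℂ A z - G) := by
      have hopen : IsOpen {a : A | IsUnit a} := Units.isOpen
      have hcont : Continuous fun z : ℂ => algebraMap ℂ A z - G := by fun_prop
      exact (hopen.preimage hcont).mem_nhds (by simpa using hG.neg)
    have h2 : ∀ᶠ z : ℂ in 𝓝 0, s - z ≠ 0 := by
      have : Continuous fun z : ℂ => s - z := by fun_prop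
      exact this.continuousAt.eventually_ne (by simpa using hs)
    filter_upwards [h1, h2] with z hz1 hz2 hz
    by_contra hz0
    apply hz
    -- On the range of E, z - D acts as z and z - G as z - s. The second factor corrects the ratio
    -- and is inverted by inverting its scalar.
    have hfac : algebraMap ℂ A z - D
        = (algebraMap ℂ A z - G) * ((1 - E) + (z / (z - s)) • E) := by
      have hz3 : z - s ≠ 0 := by rwa [← neg_ne_zero, neg_sub]
      have h5 : (algebraMap ℂ A z - G) * E = (z - s) • E := by
        rw [sub_mul, hGE, sub_smul, Algebra.algebraMap_eq_smul_one, smul_mul_assoc, one_mul]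
      rw [mul_add, mul_smul_comm, h5, smul_smul, div_mul_cancel₀ _ hz3, mul_sub (_ - _), h5, hD,
        mul_sub, hGE, Algebra.algebraMap_eq_smul_one, mul_one, mul_one]
      module
    have hv : IsUnit ((1 - E) + (z / (z - s)) • E) := by
      have hz3 : z - s ≠ 0 := by rwa [← neg_ne_zero, neg_sub]
      have hc : ∀ c d : ℂ, c * d = 1 → ((1 - E) + c • E) * ((1 - E) + d • E) = 1 := by
        intro c d hcd
        rw [add_mul, mul_add, mul_add, smul_mul_smul_comm, hE, hcd, smul_mul_assoc, hEF,
          mul_smul_comm, hFE, mul_sub (1 - E), hFE]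
        simp
      refine ⟨⟨_, _, hc (z / (z - s)) ((z - s) / z) ?_, hc _ _ ?_⟩, rfl⟩ <;> field_simp
    rw [spectrum.mem_resolventSet_iff, hfac]
    exact hz1.mul hv
  obtain ⟨r, hr, hball⟩ := Metric.eventually_nhds_iff.1 hiso
  intro hpre
  obtain ⟨z, hz, hzu, hzv⟩ := hpre (Metric.ball 0 r) {0}ᶜ Metric.isOpen_ball
    isOpen_compl_singleton (fun z _ => by
      by_cases h : z = 0
      · left; simpa [h] using hr
      · right; exact h) ⟨0, hzero, by simpa using hr⟩ ⟨w, hw, hw0⟩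
  exact hzv (hball hzu hz)

end Banach

/-! ### Spectral projections and unitaries in a von Neumann algebra. -/

variable {H : Type*} [NormedAddCommGroup H] [InnerProductSpace ℂ H] [CompleteSpace H]

lemma mem_of_commute_commutant (M : VonNeumannAlgebra H) {A : H →L[ℂ] H}
    (h : ∀ B ∈ M.commutant, B * A = A * B) : A ∈ M := by
  rw [← M.commutant_commutant]
  exact VonNeumannAlgebra.mem_commutant_iff.2 h

lemma smul_mem_vonNeumann (M : VonNeumannAlgebra H) (c : ℂ) {A : H →L[ℂ] H} (hA : A ∈ M) :
    c • A ∈ M :=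
  M.toStarSubalgebra.smul_mem hA c

lemma smul_one_mem_vonNeumann (M : VonNeumannAlgebra H) (c : ℂ) :
    c • (1 : H →L[ℂ] H) ∈ M :=
  smul_mem_vonNeumann M c (one_mem M)

/-- The orthogonal projection onto a subspace invariant under the commutant lies in the algebra. -/
lemma starProjection_mem_of_invariant (M : VonNeumannAlgebra H) (K : Submodule ℂ H)
    [K.HasOrthogonalProjection] (h : ∀ B ∈ M.commutant, ∀ x ∈ K, B x ∈ K) :
    K.starProjection ∈ M := by
  rw [VonNeumannAlgebra.IsStarProjection.mem_iff isStarProjection_starProjection]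
  intro y hy
  rw [Submodule.range_starProjection, Module.End.mem_invtSubmodule]
  exact fun x hx => h y hy x hx

/-- A positive operator plus a positive scalar `a` has an inverse of norm at most `a⁻¹`. -/
lemma exists_units_eq_add_smul_one {N : H →L[ℂ] H} (hN : 0 ≤ N) {a : ℝ} (ha : 0 < a) :
    ∃ u : (H →L[ℂ] H)ˣ, (u : H →L[ℂ] H) = N + (a : ℂ) • 1 ∧ ‖(↑u⁻¹ : H →L[ℂ] H)‖ ≤ a⁻¹ := by
  set R : H →L[ℂ] H := N + (a : ℂ) • 1 with hR
  have hlow : ∀ x, a * ‖x‖ ≤ ‖R x‖ := fun x => by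
    have h1 : a * ‖x‖ ^ 2 ≤ (inner ℂ (R x) x).re := by
      have h0 := ((nonneg_iff_isPositive _).1 hN).re_inner_nonneg_left x
      simp only [RCLike.re_to_complex] at h0
      have : (inner ℂ (R x) x).re = (inner ℂ (N x) x).re + a * ‖x‖ ^ 2 := by
        simp [hR, inner_self_eq_norm_sq_to_K, ← Complex.ofReal_pow]
      linarith
    have h2 : (inner ℂ (R x) x).re ≤ ‖R x‖ * ‖x‖ :=
      (Complex.re_le_norm _).trans (norm_inner_le_norm _ _)
    rcases (norm_nonneg x).eq_or_lt with h | h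
    · rw [← h]; simp
    · nlinarith
  have hRu : IsUnit R := by
    have h2 : algebraMap ℝ (H →L[ℂ] H) a = (a : ℂ) • 1 := by
      rw [Algebra.algebraMap_eq_smul_one]; rfl
    have h3 : IsStrictlyPositive (algebraMap ℝ (H →L[ℂ] H) a) :=
      ((IsUnit.mk0 a ha.ne').map (algebraMap ℝ (H →L[ℂ] H))).isStrictlyPositive
        (algebraMap_nonneg _ ha.le)
    refine CStarAlgebra.isUnit_of_le (algebraMap ℝ (H →L[ℂ] H) a) ?_ h3
    rw [hR, h2]
    exact le_add_of_nonneg_left hN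
  obtain ⟨u, hu⟩ := hRu
  refine ⟨u, hu, opNorm_le_bound _ (inv_nonneg.2 ha.le) fun x => ?_⟩
  have h2 := hlow ((↑u⁻¹ : H →L[ℂ] H) x)
  have h3 : R ((↑u⁻¹ : H →L[ℂ] H) x) = x := by
    rw [← hu]
    exact DFunLike.congr_fun u.mul_inv x
  rw [h3] at h2
  rw [inv_mul_eq_div, le_div_iff₀ ha]
  linarith

/-- A spectral projection of a self-adjoint element for the interval `(-∞, a]`, together with an
inverse of the element on the complement. -/
lemma exists_spectral_projection (M : VonNeumannAlgebra H) {S : H →L[ℂ] H} (hS : S ∈ M)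
    (hsa : IsSelfAdjoint S) (a : ℝ) :
    ∃ P ∈ M, IsStarProjection P ∧
      (∀ x, (inner ℂ (S (P x)) (P x)).re ≤ a * ‖P x‖ ^ 2) ∧
      (P = 0 → ∀ x, a * ‖x‖ ^ 2 ≤ (inner ℂ (S x) x).re) ∧
      (0 < a → ∃ B ∈ M, 1 - P = S * B ∧ ‖B‖ ≤ a⁻¹) := by
  set A : H →L[ℂ] H := S - (a : ℂ) • 1 with hA
  have hAsa : IsSelfAdjoint A := by
    refine hsa.sub ?_
    rw [IsSelfAdjoint, star_smul, star_one]
    simp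
  have hAapp : ∀ x, S x = A x + (a : ℂ) • x := fun x => by simp [hA]
  have hdec : A⁺ - A⁻ = A := CFC.posPart_sub_negPart A hAsa
  have hpn : A⁺ * A⁻ = 0 := CFC.posPart_mul_negPart A
  have hpos : (A⁺).IsPositive := (nonneg_iff_isPositive _).1 (CFC.posPart_nonneg A)
  have hneg : (A⁻).IsPositive := (nonneg_iff_isPositive _).1 (CFC.negPart_nonneg A)
  have hinner : ∀ x, (inner ℂ (S x) x).re = (inner ℂ (A x) x).re + a * ‖x‖ ^ 2 := fun x => by
    rw [hAapp, inner_add_left, inner_smul_left, inner_self_eq_norm_sq_to_K, Complex.add_re]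
    congr 1
    simp [← Complex.ofReal_pow]
  have hcomm : ∀ B : H →L[ℂ] H, Commute S B → Commute A⁺ B := fun B hB => by
    rw [CFC.posPart_def]
    exact Commute.cfcₙ_real (hB.sub_left ((Commute.one_left B).smul_left _)) _
  -- On this kernel S = a - A⁻, which gives the upper bound. It also contains the range of A⁻, so P
  -- = 0 forces A⁻ = 0 and hence S ≥ a.
  set K : Submodule ℂ H := (A⁺).ker with hK
  have hKc : IsClosed (K : Set H) := (A⁺).isClosed_ker
  have : CompleteSpace K := hKc.completeSpace_coe
  set P := K.starProjection with hP
  have hPsp : IsStarProjection P := isStarProjection_starProjection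
  have hAP : ∀ x, A⁺ (P x) = 0 := fun x => (K.starProjection_apply_mem x : P x ∈ K)
  have hPn : P * A⁻ = A⁻ := by
    ext x
    refine Submodule.starProjection_eq_self_iff.2 ?_
    exact DFunLike.congr_fun hpn x
  have hnP : A⁻ * P = A⁻ := by
    have := congrArg star hPn
    rwa [star_mul, hPsp.isSelfAdjoint.star_eq, (IsSelfAdjoint.of_nonneg
      (CFC.negPart_nonneg A)).star_eq] at this
  have hPM : P ∈ M := by
    refine starProjection_mem_of_invariant M K fun B hB x hx => ?_
    have h1 : Commute S B := VonNeumannAlgebra.mem_commutant_iff.1 hB S hS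
    have h2 := DFunLike.congr_fun (hcomm B h1).eq x
    have h3 : A⁺ x = 0 := hx
    change A⁺ (B x) = 0
    simpa [h3] using h2
  refine ⟨P, hPM, hPsp, ?_, ?_, ?_⟩
  · intro x
    rw [hinner]
    have : A (P x) = - A⁻ (P x) := by
      conv_lhs => rw [← hdec]
      simp [hAP]
    rw [this, inner_neg_left]
    have h0 := hneg.re_inner_nonneg_left (P x)
    simp only [RCLike.re_to_complex] at h0
    simp only [Complex.neg_re]
    linarith
  · intro h0 x
    have : A⁻ = 0 := by rw [← hPn, h0, zero_mul]
    rw [hinner, ← hdec, this, sub_zero]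
    have h0 := hpos.re_inner_nonneg_left x
    simp only [RCLike.re_to_complex] at h0
    linarith
  · intro ha
    obtain ⟨u, hR, hunorm⟩ := exists_units_eq_add_smul_one (CFC.posPart_nonneg A) ha
    -- Here u = A⁺ + a is invertible even if S is not. It agrees with S on the range of 1 - P, where
    -- A⁻ vanishes.
    have hSR : S = u - A⁻ := by
      have : S = A + (a : ℂ) • 1 := by rw [hA, sub_add_cancel]
      rw [this, hR, add_sub_right_comm, hdec]
    have hE : S * (1 - P) = u * (1 - P) := by
      rw [hSR, sub_mul, mul_sub (A⁻), hnP, mul_one, sub_self, sub_zero]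
    have hcomm' : ∀ B, Commute S B → Commute (u : H →L[ℂ] H) B := fun B hB => by
      rw [hR]
      exact (hcomm B hB).add_left ((Commute.one_left B).smul_left _)
    have huS : Commute (↑u⁻¹ : H →L[ℂ] H) S := (hcomm' S (Commute.refl S)).units_inv_left
    have huM : (↑u⁻¹ : H →L[ℂ] H) ∈ M :=
      mem_of_commute_commutant M fun B hB =>
        (hcomm' B (VonNeumannAlgebra.mem_commutant_iff.1 hB S hS)).units_inv_left.eq.symm
    refine ⟨↑u⁻¹ * (1 - P), mul_mem huM (sub_mem (one_mem M) hPM), ?_, ?_⟩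
    · rw [← mul_assoc, ← huS.eq, mul_assoc, hE, ← mul_assoc, Units.inv_mul, one_mul]
    · have h4 : ‖1 - P‖ ≤ 1 := hPsp.one_sub.norm_le
      calc ‖(↑u⁻¹ : H →L[ℂ] H) * (1 - P)‖ ≤ ‖(↑u⁻¹ : H →L[ℂ] H)‖ * ‖1 - P‖ := norm_mul_le _ _
        _ ≤ a⁻¹ * 1 := mul_le_mul hunorm h4 (norm_nonneg _) (inv_nonneg.2 ha.le)
        _ = a⁻¹ := mul_one _

lemma isClosed_vonNeumannAlgebra (M : VonNeumannAlgebra H) :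
    IsClosed (M.toStarSubalgebra : Set (H →L[ℂ] H)) := by
  rw [VonNeumannAlgebra.coe_toStarSubalgebra, ← M.centralizer_centralizer]
  exact Set.isClosed_centralizer _

/-- Every element of a von Neumann algebra is a combination of four unitaries of the algebra. -/
lemma exists_sum_four_unitary (M : VonNeumannAlgebra H) {A : H →L[ℂ] H} (hA : A ∈ M) :
    ∃ (u : Fin 4 → H →L[ℂ] H) (c : Fin 4 → ℂ), (∀ i, u i ∈ M) ∧
      (∀ i, u i ∈ unitary (H →L[ℂ] H)) ∧ A = ∑ i, c i • u i ∧ ∀ i, ‖c i‖ ≤ ‖A‖ / 2 := by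
  let _ : CStarAlgebra M.toStarSubalgebra :=
    StarSubalgebra.cstarAlgebra _ (h_closed := isClosed_vonNeumannAlgebra M)
  obtain ⟨u, c, h1, h2⟩ :=
    CStarAlgebra.exists_sum_four_unitary (⟨A, hA⟩ : M.toStarSubalgebra)
  refine ⟨fun i => ((u i : M.toStarSubalgebra) : H →L[ℂ] H), c, fun i => (u i).1.2,
    fun i => ?_, ?_, h2⟩
  · obtain ⟨h3, h4⟩ := Unitary.mem_iff.1 (u i).2
    exact Unitary.mem_iff.2 ⟨congrArg Subtype.val h3, congrArg Subtype.val h4⟩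
  · have := congrArg Subtype.val h1
    simpa using this

lemma re_inner_star_mul_self (R : H →L[ℂ] H) (x : H) :
    (inner ℂ ((star R * R) x) x).re = ‖R x‖ ^ 2 := by
  have : inner ℂ ((star R * R) x) x = inner ℂ (R x) (R x) := adjoint_inner_left R x (R x)
  rw [this, inner_self_eq_norm_sq_to_K]
  simp [← Complex.ofReal_pow]

/-! ### Unitarily invariant norms: multiplication by M and domination of projections. -/

section Norm

variable {M : VonNeumannAlgebra H} {I : Submodule ℂ (H →L[ℂ] H)} {hI : IsTwoSidedIdeal M I}
  {Φ : Seminorm ℂ I}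

omit [CompleteSpace H] in
lemma seminorm_sum_smul_le (Φ : Seminorm ℂ I) (Y : Fin 4 → I) (c : Fin 4 → ℂ) {r t : ℝ}
    (hc : ∀ i, ‖c i‖ ≤ r / 2) (hY : ∀ i, Φ (Y i) = t) :
    Φ (∑ i, c i • Y i) ≤ 2 * r * t := by
  have ht : 0 ≤ t := hY 0 ▸ apply_nonneg Φ _
  calc Φ (∑ i, c i • Y i) ≤ ∑ i, Φ (c i • Y i) :=
      Finset.le_sum_of_subadditive Φ (map_zero Φ).le (map_add_le_add Φ) _ _
    _ ≤ ∑ _i : Fin 4, r / 2 * t := by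
      refine Finset.sum_le_sum fun i _ => ?_
      rw [map_smul_eq_mul, hY]
      exact mul_le_mul_of_nonneg_right (hc i) ht
    _ = 2 * r * t := by simp; ring

/-- The factor 2 is the cost of passing from unitaries to all of M: A is a sum of four unitaries
with coefficients of modulus at most ‖A‖/2. -/
lemma apply_mul_left_le (hinv : IsUnitarilyInvariant hI Φ) {A : H →L[ℂ] H} (hA : A ∈ M) (X : I) :
    Φ ⟨A * X, hI.mul_mem_left A hA X X.2⟩ ≤ 2 * ‖A‖ * Φ X := by
  obtain ⟨u, c, huM, hu, h1, h2⟩ := exists_sum_four_unitary M hA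
  have h3 : (⟨A * X, hI.mul_mem_left A hA X X.2⟩ : I) = ∑ i, c i •
      (⟨u i * X * 1, hI.mul_mem_right _ (one_mem M) _ (hI.mul_mem_left _ (huM i) X X.2)⟩ : I) := by
    apply Subtype.ext
    simp only [AddSubmonoidClass.coe_finsetSum, SetLike.val_smul, mul_one]
    conv_lhs => rw [h1]
    rw [Finset.sum_mul]
    simp only [smul_mul_assoc]
  rw [h3]
  exact seminorm_sum_smul_le Φ _ c h2 fun i => hinv _ _ (huM i) (one_mem M) (hu i) (one_mem _) X

lemma apply_mul_right_le (hinv : IsUnitarilyInvariant hI Φ) {A : H →L[ℂ] H} (hA : A ∈ M) (X : I) :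
    Φ ⟨X * A, hI.mul_mem_right A hA X X.2⟩ ≤ 2 * ‖A‖ * Φ X := by
  obtain ⟨u, c, huM, hu, h1, h2⟩ := exists_sum_four_unitary M hA
  have h3 : (⟨X * A, hI.mul_mem_right A hA X X.2⟩ : I) = ∑ i, c i •
      (⟨1 * X * u i, hI.mul_mem_right _ (huM i) _ (hI.mul_mem_left _ (one_mem M) X X.2)⟩ : I) := by
    apply Subtype.ext
    simp only [AddSubmonoidClass.coe_finsetSum, SetLike.val_smul, one_mul]
    conv_lhs => rw [h1]
    rw [Finset.mul_sum]
    simp only [mul_smul_comm]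
  rw [h3]
  exact seminorm_sum_smul_le Φ _ c h2 fun i => hinv _ _ (one_mem M) (huM i) (one_mem _) (hu i) X

/-- A nonzero element `X` of the ideal dominates a nonzero projection of the ideal. -/
lemma exists_projection_of_ne_zero (hinv : IsUnitarilyInvariant hI Φ) (X : I) (hX : X ≠ 0) :
    ∃ E : I, IsStarProjection (E : H →L[ℂ] H) ∧ E ≠ 0 ∧ Φ E * ‖(X : H →L[ℂ] H)‖ ≤ 4 * Φ X ∧
      ∃ C ∈ M, (E : H →L[ℂ] H) = C * X := by
  obtain ⟨X, hXI⟩ := X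
  have hX0 : X ≠ 0 := fun h => hX (Subtype.ext h)
  have hXn : 0 < ‖X‖ := norm_pos_iff.2 hX0
  have hXM : X ∈ M := hI.subset X hXI
  have hSM : star X * X ∈ M := mul_mem (star_mem hXM) hXM
  have ha : 0 < ‖X‖ ^ 2 / 2 := by positivity
  -- Cutting X*X at half its norm keeps 1 - P nonzero, while 1 - P = (B*X*)X with ‖B*X*‖ ≤ 2/‖X‖.
  -- Together with the factor 2 for multiplication by M this gives the constant 4.
  obtain ⟨P, hPM, hP, hP1, -, hP3⟩ := exists_spectral_projection M hSM
    (IsSelfAdjoint.star_mul_self X) (‖X‖ ^ 2 / 2)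
  obtain ⟨B, hB, hPB, hBn⟩ := hP3 ha
  have hE : 1 - P = star B * star X * X := by
    rw [← hP.one_sub.isSelfAdjoint.star_eq, hPB, star_mul, star_mul, star_star, mul_assoc]
  have hCM : star B * star X ∈ M := mul_mem (star_mem hB) (star_mem hXM)
  have hEI : 1 - P ∈ I := hE ▸ hI.mul_mem_left _ hCM X hXI
  refine ⟨⟨1 - P, hEI⟩, hP.one_sub, ?_, ?_, star B * star X, hCM, hE⟩
  · intro h
    have hP1' : P = 1 := (sub_eq_zero.1 (congrArg Subtype.val h)).symm
    have hle : ‖X‖ ≤ Real.sqrt (‖X‖ ^ 2 / 2) := by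
      refine opNorm_le_bound _ (Real.sqrt_nonneg _) fun x => ?_
      have h1 := hP1 x
      rw [hP1'] at h1
      rw [re_inner_star_mul_self] at h1
      have h3 : ‖X x‖ ^ 2 ≤ (Real.sqrt (‖X‖ ^ 2 / 2) * ‖x‖) ^ 2 := by
        rw [mul_pow, Real.sq_sqrt ha.le]
        exact h1
      exact le_of_sq_le_sq h3 (by positivity)
    have := Real.sqrt_le_sqrt (show ‖X‖ ^ 2 / 2 ≤ ‖X‖ ^ 2 by linarith)
    have h4 : ‖X‖ ^ 2 ≤ ‖X‖ ^ 2 / 2 := by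
      have h5 := pow_le_pow_left₀ hXn.le hle 2
      rwa [Real.sq_sqrt ha.le] at h5
    linarith
  · have h1 := apply_mul_left_le hinv hCM ⟨X, hXI⟩
    have h2 : (⟨1 - P, hEI⟩ : I) = ⟨star B * star X * X, hI.mul_mem_left _ hCM X hXI⟩ :=
      Subtype.ext hE
    have h3 : ‖star B * star X‖ ≤ (‖X‖ ^ 2 / 2)⁻¹ * ‖X‖ := by
      refine (norm_mul_le _ _).trans ?_
      rw [norm_star, norm_star]
      exact mul_le_mul_of_nonneg_right hBn hXn.le
    have h4 : 0 ≤ Φ ⟨X, hXI⟩ := apply_nonneg _ _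
    rw [h2]
    calc _ ≤ (2 * ‖star B * star X‖ * Φ ⟨X, hXI⟩) * ‖X‖ :=
          mul_le_mul_of_nonneg_right h1 hXn.le
      _ ≤ (2 * ((‖X‖ ^ 2 / 2)⁻¹ * ‖X‖) * Φ ⟨X, hXI⟩) * ‖X‖ := by gcongr
      _ = 4 * Φ ⟨X, hXI⟩ := by field_simp; ring

end Norm

/-! ### Nontrivial projections and approximate eigenvectors. -/

/-- A self-adjoint element of a von Neumann algebra without nontrivial projections is a scalar. -/
lemma eq_smul_one_of_forall_projection (M : VonNeumannAlgebra H)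
    (h : ∀ Q ∈ M, IsStarProjection Q → Q = 0 ∨ Q = 1) {S : H →L[ℂ] H} (hS : S ∈ M)
    (hsa : IsSelfAdjoint S) : ∃ c : ℂ, S = c • 1 := by
  -- All Rayleigh quotients coincide: the spectral projection at a level strictly between two of
  -- them could be neither 0 nor 1.
  have hle : ∀ x y : H, x ≠ 0 → y ≠ 0 →
      (inner ℂ (S y) y).re / ‖y‖ ^ 2 ≤ (inner ℂ (S x) x).re / ‖x‖ ^ 2 := by
    intro x y hx hy
    by_contra! hlt
    obtain ⟨a, ha1, ha2⟩ := exists_between hlt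
    have hx' : 0 < ‖x‖ ^ 2 := by positivity
    have hy' : 0 < ‖y‖ ^ 2 := by positivity
    obtain ⟨P, hPM, hP, hP1, hP2, -⟩ := exists_spectral_projection M hS hsa a
    rcases h P hPM hP with h0 | h0
    · have := hP2 h0 x
      rw [div_lt_iff₀ hx'] at ha1
      linarith
    · have := hP1 y
      rw [h0] at this
      change (inner ℂ (S y) y).re ≤ a * ‖y‖ ^ 2 at this
      rw [lt_div_iff₀ hy'] at ha2
      linarith
  rcases subsingleton_or_nontrivial H with hH | hH
  · exact ⟨0, Subsingleton.elim _ _⟩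
  obtain ⟨x₀, hx₀⟩ := exists_ne (0 : H)
  set c : ℝ := (inner ℂ (S x₀) x₀).re / ‖x₀‖ ^ 2 with hc
  refine ⟨c, ?_⟩
  have hzero : ((S - (c : ℂ) • 1 : H →L[ℂ] H) : H →ₗ[ℂ] H) = 0 := by
    rw [← inner_map_self_eq_zero]
    intro x
    by_cases hx : x = 0
    · simp [hx]
    have h1 : (inner ℂ (S x) x).re = c * ‖x‖ ^ 2 := by
      rw [← div_eq_iff (by positivity)]
      exact le_antisymm (hle _ _ hx₀ hx) (hle _ _ hx hx₀)
    have h2 : inner ℂ (S x) x = ((inner ℂ (S x) x).re : ℂ) := by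
      have := (isSelfAdjoint_iff_isSymmetric.1 hsa).coe_re_inner_apply_self x
      simpa using this.symm
    have h3 : inner ℂ ((S - (c : ℂ) • 1 : H →L[ℂ] H) x) x
        = inner ℂ (S x) x - (c : ℂ) * (‖x‖ ^ 2 : ℂ) := by
      simp [inner_self_eq_norm_sq_to_K]
    change inner ℂ ((S - (c : ℂ) • 1 : H →L[ℂ] H) x) x = 0
    rw [h3, h2, h1]
    push_cast
    ring
  have h4 : S - (c : ℂ) • 1 = 0 := by
    ext x
    exact DFunLike.congr_fun hzero x
  exact sub_eq_zero.1 h4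

/-- Otherwise the real and imaginary parts of every element are scalars, by
`eq_smul_one_of_forall_projection`, and the dimension is at most one. -/
lemma exists_nontrivial_projection (M : VonNeumannAlgebra H)
    (hM : 1 < Module.rank ℂ M.toStarSubalgebra) :
    ∃ Q ∈ M, IsStarProjection Q ∧ Q ≠ 0 ∧ Q ≠ 1 := by
  by_contra! hcon
  have h : ∀ Q ∈ M, IsStarProjection Q → Q = 0 ∨ Q = 1 := fun Q h1 h2 =>
    or_iff_not_imp_left.2 (hcon Q h1 h2)
  refine hM.not_ge (rank_le_one_iff.2 ⟨⟨1, one_mem M⟩, fun ⟨T, hT⟩ => ?_⟩)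
  have hT : T ∈ M := hT
  have hmem : ∀ X ∈ M, ∀ c : ℂ, c • X ∈ M := fun X hX c => smul_mem_vonNeumann M c hX
  obtain ⟨c, hc⟩ := eq_smul_one_of_forall_projection M h (add_mem hT (star_mem hT))
    (IsSelfAdjoint.add_star_self T)
  obtain ⟨d, hd⟩ := eq_smul_one_of_forall_projection M h
    (hmem _ (sub_mem hT (star_mem hT)) Complex.I) (by
      rw [IsSelfAdjoint, star_smul, star_sub, star_star]
      simp only [RCLike.star_def, Complex.conj_I]
      module)
  refine ⟨(c - Complex.I * d) / 2, Subtype.ext ?_⟩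
  change ((c - Complex.I * d) / 2) • (1 : H →L[ℂ] H) = T
  have : ((c - Complex.I * d) / 2) • (1 : H →L[ℂ] H)
      = (1 / 2 : ℂ) • (c • 1 - Complex.I • d • 1) := by module
  rw [this, ← hc, ← hd, smul_smul, Complex.I_mul_I]
  module

/-- If T - z were bounded below by δ, the invertible operator z + δ/4 - T would be bounded below by
3δ/4. Moving it by δ/4 < 3δ/4 would keep it invertible, so z would not be in the spectrum. -/
lemma exists_norm_lt_of_mem_spectrum [Nontrivial H] {T : H →L[ℂ] H} {z : ℂ}
    (hz : z ∈ spectrum ℂ T) (hs : ∀ s : ℝ, 0 < s → z + s ∉ spectrum ℂ T) {δ : ℝ} (hδ : 0 < δ) :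
    ∃ x, ‖(T - z • (1 : H →L[ℂ] H)) x‖ < δ * ‖x‖ := by
  by_contra! hcon
  have h1 := hs (δ / 4) (by positivity)
  rw [spectrum.notMem_iff, Algebra.algebraMap_eq_smul_one] at h1
  obtain ⟨u, hu⟩ := h1
  have hu' : ∀ x, (u : H →L[ℂ] H) x = ((δ / 4 : ℝ) : ℂ) • x - (T - z • (1 : H →L[ℂ] H)) x := by
    intro x
    rw [hu]
    change (z + ((δ / 4 : ℝ) : ℂ)) • x - T x = ((δ / 4 : ℝ) : ℂ) • x - (T x - z • x)
    module
  have hlow : ∀ x, 3 * δ / 4 * ‖x‖ ≤ ‖(u : H →L[ℂ] H) x‖ := fun x => by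
    rw [hu', norm_sub_rev]
    have h2 := norm_sub_norm_le ((T - z • (1 : H →L[ℂ] H)) x) (((δ / 4 : ℝ) : ℂ) • x)
    have h3 : ‖((δ / 4 : ℝ) : ℂ) • x‖ = δ / 4 * ‖x‖ := by
      rw [norm_smul, Complex.norm_real, Real.norm_of_nonneg (by positivity)]
    have := hcon x
    rw [h3] at h2
    linarith
  have hinv : ‖(↑u⁻¹ : H →L[ℂ] H)‖ ≤ (3 * δ / 4)⁻¹ := by
    refine opNorm_le_bound _ (by positivity) fun x => ?_
    have h2 := hlow ((↑u⁻¹ : H →L[ℂ] H) x)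
    have h3 : (u : H →L[ℂ] H) ((↑u⁻¹ : H →L[ℂ] H) x) = x := DFunLike.congr_fun u.mul_inv x
    rw [h3] at h2
    rw [inv_mul_eq_div, le_div_iff₀ (by positivity)]
    linarith
  have hlt : ‖(algebraMap ℂ (H →L[ℂ] H) z - T) - u‖ < ‖(↑u⁻¹ : H →L[ℂ] H)‖⁻¹ := by
    have h2 : (algebraMap ℂ (H →L[ℂ] H) z - T) - u
        = (-((δ / 4 : ℝ) : ℂ)) • (1 : H →L[ℂ] H) := by
      rw [hu, Algebra.algebraMap_eq_smul_one]
      module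
    rw [h2, norm_smul, norm_neg, Complex.norm_real, Real.norm_of_nonneg (by positivity), norm_one,
      mul_one]
    have h3 : 0 < ‖(↑u⁻¹ : H →L[ℂ] H)‖ := norm_pos_iff.2 (Units.ne_zero _)
    rw [lt_inv_comm₀ (by positivity) h3]
    refine hinv.trans_lt (inv_strictAnti₀ (by positivity) (by linarith))
  exact hz ⟨u.ofNearby _ hlt, rfl⟩

lemma exists_mem_spectrum_max_re [Nontrivial H] (T : H →L[ℂ] H) :
    ∃ z ∈ spectrum ℂ T, ∀ s : ℝ, 0 < s → z + s ∉ spectrum ℂ T := by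
  obtain ⟨z, hz, hmax⟩ := (spectrum.isCompact (𝕜 := ℂ) T).exists_isMaxOn (spectrum.nonempty T)
    Complex.continuous_re.continuousOn
  refine ⟨z, hz, fun s hs hzs => ?_⟩
  have : (z + s).re ≤ z.re := hmax hzs
  simp only [Complex.add_re, Complex.ofReal_re] at this
  linarith

/-! ### Finite supremum: disconnecting the spectrum. -/

section Norm

variable {M : VonNeumannAlgebra H} {I : Submodule ℂ (H →L[ℂ] H)} {hI : IsTwoSidedIdeal M I}
  {Φ : Seminorm ℂ I}

/-- If `R ∈ M` is not bounded below, some nontrivial projection of the ideal, of controlled norm,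
almost annihilates `R`. -/
lemma exists_projection_norm_mul_le (hM : 1 < Module.rank ℂ M.toStarSubalgebra)
    (hinv : IsUnitarilyInvariant hI Φ) (hc : cPhi M Φ < ∞) {R : H →L[ℂ] H} (hR : R ∈ M)
    {δ : ℝ} (hδ : 0 < δ) (hlow : ∃ x, ‖R x‖ < δ * ‖x‖) :
    ∃ E : I, IsStarProjection (E : H →L[ℂ] H) ∧ (E : H →L[ℂ] H) ≠ 0 ∧ (E : H →L[ℂ] H) ≠ 1 ∧
      Φ E ≤ 2 * ((cPhi M Φ).toReal + 1) ∧ ‖R * E‖ ≤ δ := by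
  obtain ⟨P, hPM, hP, hP1, hP2, -⟩ := exists_spectral_projection M
    (mul_mem (star_mem hR) hR) (IsSelfAdjoint.star_mul_self R) (δ ^ 2)
  have hP0 : P ≠ 0 := by
    intro h0
    obtain ⟨x, hx⟩ := hlow
    have h1 := hP2 h0 x
    rw [re_inner_star_mul_self, ← mul_pow] at h1
    exact absurd (le_of_sq_le_sq h1 (norm_nonneg _)) (not_le.2 hx)
  have hRP : ‖R * P‖ ≤ δ := by
    refine opNorm_le_bound _ hδ.le fun x => ?_
    have h1 := hP1 x
    rw [re_inner_star_mul_self, ← mul_pow] at h1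
    have h2 : ‖P x‖ ≤ ‖x‖ := by
      simpa using P.le_of_opNorm_le hP.norm_le x
    calc ‖R (P x)‖ ≤ δ * ‖P x‖ := le_of_sq_le_sq h1 (by positivity)
      _ ≤ δ * ‖x‖ := by gcongr
  have hlt : fPhi Φ P < ENNReal.ofReal ((cPhi M Φ).toReal + 1) := by
    refine (le_iSup (fun P : {P : H →L[ℂ] H // P ∈ M ∧ IsStarProjection P ∧ P ≠ 0} =>
      fPhi Φ P) ⟨P, hPM, hP, hP0⟩).trans_lt ?_
    change cPhi M Φ < _
    rw [ENNReal.lt_ofReal_iff_toReal_lt hc.ne]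
    linarith
  rw [fPhi, iInf_lt_iff] at hlt
  obtain ⟨⟨E, hE, hE0, hEP⟩, hEΦ⟩ := hlt
  have hEΦ' : Φ E < (cPhi M Φ).toReal + 1 := (ENNReal.ofReal_lt_ofReal_iff (by positivity)).1 hEΦ
  have hE0' : (E : H →L[ℂ] H) ≠ 0 := fun h => hE0 (Subtype.ext h)
  have hRE : ‖R * E‖ ≤ δ := by
    rw [← (hE.le_iff_mul_eq_right hP).1 hEP, ← mul_assoc]
    calc _ ≤ ‖R * P‖ * ‖(E : H →L[ℂ] H)‖ := norm_mul_le _ _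
      _ ≤ δ * 1 := mul_le_mul hRP hE.norm_le (norm_nonneg _) hδ.le
      _ = δ := mul_one _
  have hpos : 0 ≤ (cPhi M Φ).toReal := ENNReal.toReal_nonneg
  -- If E = 1 then ‖R‖ ≤ δ already, so any nontrivial projection Q of M serves. Writing Q = QE
  -- bounds Φ(Q) by 2Φ(E), whence the 2 in the conclusion.
  by_cases hE1 : (E : H →L[ℂ] H) = 1
  · obtain ⟨Q, hQM, hQ, hQ0, hQ1⟩ := exists_nontrivial_projection M hM
    have hQE : Q * E = Q := by rw [hE1, mul_one]
    refine ⟨⟨Q * E, hI.mul_mem_left Q hQM E E.2⟩, ?_, ?_, ?_, ?_, ?_⟩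
    · simpa only [hQE] using hQ
    · simpa only [hQE] using hQ0
    · simpa only [hQE] using hQ1
    · refine (apply_mul_left_le hinv hQM E).trans ?_
      have h1 := hQ.norm_le
      have h2 : 0 ≤ Φ E := apply_nonneg _ _
      nlinarith
    · rw [hE1, mul_one] at hRE
      simp only [hQE]
      calc _ ≤ ‖R‖ * ‖Q‖ := norm_mul_le _ _
        _ ≤ δ * 1 := mul_le_mul hRE hQ.norm_le (norm_nonneg _) hδ.le
        _ = δ := mul_one _
  · exact ⟨E, hE, hE0', hE1, by linarith, hRE⟩

theorem exists_not_isPreconnected_of_cPhi_lt_top (hM : 1 < Module.rank ℂ M.toStarSubalgebra)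
    (hinv : IsUnitarilyInvariant hI Φ) (hc : cPhi M Φ < ∞) {T : H →L[ℂ] H} (hT : T ∈ M)
    {ε : ℝ} (hε : 0 < ε) :
    ∃ X : I, Φ X < ε ∧ ¬ IsPreconnected (spectrum ℂ (T + (X : H →L[ℂ] H))) := by
  have hH : Nontrivial H := by
    by_contra hH
    rw [not_nontrivial_iff_subsingleton] at hH
    obtain ⟨Q, -, -, hQ, -⟩ := exists_nontrivial_projection M hM
    exact hQ (Subsingleton.elim _ _)
  obtain ⟨z, hz, hmax⟩ := exists_mem_spectrum_max_re T
  set c := (cPhi M Φ).toReal + 1 with hcdef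
  have hcpos : 0 < c := by positivity
  -- Since Φ(E) ≤ 2c and δ < s, the perturbation has Φ at most (s + 2δ)·2c < 6sc = 3ε/4.
  set s : ℝ := ε / (8 * c) with hsdef
  have hs : 0 < s := by positivity
  set μ : ℂ := z + s with hμ
  have hμT : IsUnit (T - μ • (1 : H →L[ℂ] H)) := by
    have := hmax s hs
    rw [spectrum.notMem_iff, Algebra.algebraMap_eq_smul_one] at this
    simpa using this.neg
  obtain ⟨u, hu⟩ := hμT
  have hupos : 0 < ‖(↑u⁻¹ : H →L[ℂ] H)‖⁻¹ := inv_pos.2 (norm_pos_iff.2 (Units.ne_zero _))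
  obtain ⟨δ, hδ, hδlt⟩ := exists_between (lt_min hupos hs)
  obtain ⟨hδu, hδs⟩ := lt_min_iff.1 hδlt
  set R := T - z • (1 : H →L[ℂ] H) with hR
  have hRM : R ∈ M := sub_mem hT (smul_one_mem_vonNeumann M z)
  obtain ⟨E, hE, hE0, hE1, hEΦ, hRE⟩ := exists_projection_norm_mul_le hM hinv hc hRM hδ
    (exists_norm_lt_of_mem_spectrum hz hmax hδ)
  have hREM : R * E ∈ M := mul_mem hRM (hI.subset _ E.2)
  have hEE : (E : H →L[ℂ] H) * E = E := hE.isIdempotentElem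
  -- The redundant E lets `apply_mul_left_le` use the small factor ‖RE‖ instead of ‖R‖.
  set Y : I := ⟨R * E * E, hI.mul_mem_left _ hREM _ E.2⟩ with hY
  refine ⟨(s : ℂ) • E - Y, ?_, ?_⟩
  · have h1 : Φ Y ≤ 2 * ‖R * E‖ * Φ E := apply_mul_left_le hinv hREM E
    have h2 : Φ ((s : ℂ) • E) = s * Φ E := by
      rw [map_smul_eq_mul, Complex.norm_real, Real.norm_of_nonneg hs.le]
    have h3 : Φ ((s : ℂ) • E - Y) ≤ Φ ((s : ℂ) • E) + Φ Y := map_sub_le_add Φ _ _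
    have h4 : 0 ≤ Φ E := apply_nonneg _ _
    have h5 : Φ ((s : ℂ) • E - Y) ≤ (s + 2 * δ) * Φ E := by nlinarith
    have h6 : (s + 2 * δ) * Φ E ≤ (s + 2 * δ) * (2 * c) := by gcongr
    have h7 : (s + 2 * δ) * (2 * c) < (3 * s) * (2 * c) := by gcongr; linarith
    have h8 : (3 * s) * (2 * c) = 3 / 4 * ε := by rw [hsdef]; field_simp; ring
    linarith
  · set G : H →L[ℂ] H := T - μ • 1 - R * E with hG
    have hGunit : IsUnit G := by
      refine ⟨u.ofNearby G ?_, rfl⟩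
      rw [hG, ← hu, sub_sub_cancel_left, norm_neg]
      exact hRE.trans_lt hδu
    have hGE : G * E = (-(s : ℂ)) • (E : H →L[ℂ] H) := by
      rw [hG, sub_mul, mul_assoc R, hEE, ← sub_mul, hR, hμ]
      have : T - (z + (s : ℂ)) • (1 : H →L[ℂ] H) - (T - z • 1) = (-(s : ℂ)) • 1 := by module
      rw [this, smul_mul_assoc, one_mul]
    have hnot := not_isPreconnected_spectrum_mul hGunit hEE hE0 hE1
      (neg_ne_zero.2 (Complex.ofReal_ne_zero.2 hs.ne')) hGE
    intro hpre
    apply hnot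
    have hsum : T + (((s : ℂ) • E - Y : I) : H →L[ℂ] H) - algebraMap ℂ (H →L[ℂ] H) μ
        = G * (1 - E) := by
      rw [mul_sub, mul_one, hGE, hG, Algebra.algebraMap_eq_smul_one]
      have : (((s : ℂ) • E - Y : I) : H →L[ℂ] H) = (s : ℂ) • (E : H →L[ℂ] H) - R * E := by
        rw [← hEE, ← mul_assoc, hEE]; rfl
      rw [this]
      module
    rw [← hsum, ← spectrum.sub_singleton_eq, Set.sub_singleton]
    exact hpre.image _ (by fun_prop)

end Norm

/-- The pairing function makes a dense sequence revisit each of its terms infinitely often. The gap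
1/(k+1) below the unit circle absorbs the error that a perturbation causes on the k-th block. -/
lemma exists_frequently_near_seq : ∃ q : ℕ → ℂ, (∀ k : ℕ, ‖q k‖ ≤ 1 - 1 / ((k : ℝ) + 1)) ∧
    ∀ z : ℂ, ‖z‖ < 1 → ∀ δ : ℝ, 0 < δ → ∀ N : ℕ, ∃ k ≥ N, ‖q k - z‖ < δ := by
  classical
  set d : ℕ → ℂ := TopologicalSpace.denseSeq ℂ
  refine ⟨fun k => if ‖d k.unpair.1‖ ≤ 1 - 1 / ((k : ℝ) + 1) then d k.unpair.1 else 0,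
    fun k => ?_, fun z hz δ hδ N => ?_⟩
  · dsimp only
    split_ifs with h
    · exact h
    · rw [norm_zero, sub_nonneg, div_le_one (by positivity)]
      linarith [(k.cast_nonneg : (0 : ℝ) ≤ k)]
  · obtain ⟨j, hj⟩ := (TopologicalSpace.denseRange_denseSeq ℂ).exists_dist_lt z
      (lt_min hδ (sub_pos.2 hz))
    obtain ⟨hj1, hj2⟩ := lt_min_iff.1 hj
    rw [dist_comm, dist_eq_norm] at hj1 hj2
    have hdj : ‖d j‖ < 1 := by
      have := norm_le_norm_add_norm_sub' (d j) z
      have h2 : ‖d j - z‖ < 1 - ‖z‖ := hj2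
      linarith
    obtain ⟨m, hm⟩ := exists_nat_one_div_lt (sub_pos.2 hdj)
    -- An index at least N meets the request, and one at least m makes the gap small enough that the
    -- term d j is not replaced by 0.
    refine ⟨Nat.pair j (max N m), (le_max_left N m).trans (Nat.right_le_pair _ _), ?_⟩
    have hle : (m : ℝ) ≤ (Nat.pair j (max N m) : ℕ) :=
      Nat.cast_le.2 ((le_max_right N m).trans (Nat.right_le_pair _ _))
    have h3 : 1 / (((Nat.pair j (max N m) : ℕ) : ℝ) + 1) ≤ 1 / ((m : ℝ) + 1) :=
      one_div_le_one_div_of_le (by positivity) (by linarith)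
    simp only [Nat.unpair_pair]
    rw [if_pos (by linarith)]
    exact hj1

/-! ### Operators that are block diagonal for an increasing sequence of projections. -/

section Blocks

variable {p : ℕ → H →L[ℂ] H}

lemma mul_eq_right_of_le (hp : ∀ k, IsStarProjection (p k))
    (hle : ∀ i j, i ≤ j → p i * p j = p i) {i j : ℕ} (h : i ≤ j) : p j * p i = p i := by
  have := congrArg star (hle i j h)
  rwa [star_mul, (hp i).isSelfAdjoint.star_eq, (hp j).isSelfAdjoint.star_eq] at this

lemma isStarProjection_block (hp : ∀ k, IsStarProjection (p k))
    (hle : ∀ i j, i ≤ j → p i * p j = p i) (k : ℕ) : IsStarProjection (p (k + 1) - p k) :=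
  (hp k).sub_of_mul_eq_left (hp (k + 1)) (hle k (k + 1) k.le_succ)

omit [CompleteSpace H] in
lemma projection_mul_block (hle : ∀ i j, i ≤ j → p i * p j = p i) {i k : ℕ} (h : i ≤ k) :
    p i * (p (k + 1) - p k) = 0 := by
  rw [mul_sub, hle i k h, hle i (k + 1) (h.trans k.le_succ), sub_self]

omit [CompleteSpace H] in
lemma block_mul_block (hle : ∀ i j, i ≤ j → p i * p j = p i) {i k : ℕ} (h : i < k) :
    (p (i + 1) - p i) * (p (k + 1) - p k) = 0 := by
  rw [sub_mul, projection_mul_block hle h, projection_mul_block hle h.le, sub_zero]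

lemma inner_apply_eq_zero {A B : H →L[ℂ] H} (hA : IsSelfAdjoint A) (h : A * B = 0) (x y : H) :
    inner ℂ (A x) (B y) = 0 := by
  have h1 : inner ℂ (A x) (B y) = inner ℂ x (A (B y)) :=
    (isSelfAdjoint_iff_isSymmetric.1 hA) x (B y)
  have h2 : A (B y) = 0 := DFunLike.congr_fun h y
  rw [h1, h2, inner_zero_right]

omit [CompleteSpace H] in
lemma norm_sq_add_of_inner_eq_zero {x y : H} (h : inner ℂ x y = 0) :
    ‖x + y‖ ^ 2 = ‖x‖ ^ 2 + ‖y‖ ^ 2 := by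
  simpa only [sq] using norm_add_sq_eq_norm_sq_add_norm_sq_of_inner_eq_zero x y h

lemma norm_sq_projection_succ (hp : ∀ k, IsStarProjection (p k))
    (hle : ∀ i j, i ≤ j → p i * p j = p i) (k : ℕ) (x : H) :
    ‖p (k + 1) x‖ ^ 2 = ‖p k x‖ ^ 2 + ‖(p (k + 1) - p k) x‖ ^ 2 := by
  rw [← norm_sq_add_of_inner_eq_zero (inner_apply_eq_zero (hp k).isSelfAdjoint
    (projection_mul_block hle le_rfl) x x)]
  congr 2
  simp

/-- An operator commuting with an increasing sequence of projections that tends to `1` is a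
contraction if it is one on each block. -/
lemma norm_le_one_of_block (hp : ∀ k, IsStarProjection (p k))
    (hle : ∀ i j, i ≤ j → p i * p j = p i) (h0 : p 0 = 0)
    (hlim : ∀ x, Tendsto (fun k => p k x) atTop (𝓝 x)) {A : H →L[ℂ] H}
    (hA : ∀ k, Commute A (p k)) (hn : ∀ k, ‖A * (p (k + 1) - p k)‖ ≤ 1) : ‖A‖ ≤ 1 := by
  have hstep : ∀ k x, ‖A (p k x)‖ ^ 2 ≤ ‖p k x‖ ^ 2 := by
    intro k x
    induction k with
    | zero => simp [h0]
    | succ k ih =>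
      have hAW : Commute A (p (k + 1) - p k) := (hA (k + 1)).sub_right (hA k)
      have h1 : A (p (k + 1) x) = p k (A x) + (p (k + 1) - p k) (A x) := by
        have := DFunLike.congr_fun (hA (k + 1)).eq x
        change A (p (k + 1) x) = p (k + 1) (A x) at this
        rw [this]
        simp
      have h2 : A (p k x) = p k (A x) := DFunLike.congr_fun (hA k).eq x
      have h3 : A ((p (k + 1) - p k) x) = (p (k + 1) - p k) (A x) := DFunLike.congr_fun hAW.eq x
      rw [h1, norm_sq_add_of_inner_eq_zero (inner_apply_eq_zero (hp k).isSelfAdjoint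
        (projection_mul_block hle le_rfl) _ _), norm_sq_projection_succ hp hle, ← h2, ← h3]
      refine add_le_add ih (pow_le_pow_left₀ (norm_nonneg _) ?_ 2)
      have hWW := (isStarProjection_block hp hle k).isIdempotentElem
      have h4 : A ((p (k + 1) - p k) x)
          = (A * (p (k + 1) - p k)) ((p (k + 1) - p k) x) := by
        conv_lhs => rw [← hWW.eq]
        rfl
      rw [h4]
      simpa using (A * (p (k + 1) - p k)).le_of_opNorm_le (hn k) ((p (k + 1) - p k) x)
  refine opNorm_le_bound _ zero_le_one fun x => ?_
  rw [one_mul]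
  refine le_of_tendsto_of_tendsto ((A.continuous.tendsto x).comp (hlim x)).norm
    (hlim x).norm (Eventually.of_forall fun k => ?_)
  exact le_of_sq_le_sq (hstep k x) (norm_nonneg _)

lemma sum_norm_sq_block (hp : ∀ k, IsStarProjection (p k))
    (hle : ∀ i j, i ≤ j → p i * p j = p i) (n : ℕ) (x : H) :
    ‖p 0 x‖ ^ 2 + ∑ k ∈ Finset.range n, ‖(p (k + 1) - p k) x‖ ^ 2 = ‖p n x‖ ^ 2 := by
  induction n with
  | zero => simp
  | succ n ih => rw [Finset.sum_range_succ, ← add_assoc, ih, norm_sq_projection_succ hp hle]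

/-- The operator acting on the blocks of an increasing sequence of projections as given scalars. -/
lemma exists_block_scalar (hp : ∀ k, IsStarProjection (p k))
    (hle : ∀ i j, i ≤ j → p i * p j = p i) (q : ℕ → ℂ) (hq : ∀ k, ‖q k‖ ≤ 1) :
    ∃ T : H →L[ℂ] H, (∀ B, (∀ k, Commute B (p k)) → Commute B T) ∧
      ∀ k, T * (p (k + 1) - p k) = q k • (p (k + 1) - p k) := by
  set W : ℕ → H →L[ℂ] H := fun k => p (k + 1) - p k with hW
  have hWs : ∀ k, IsStarProjection (W k) := isStarProjection_block hp hle
  have hWW : ∀ i j, i ≠ j → W i * W j = 0 := by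
    intro i j hij
    rcases lt_or_gt_of_ne hij with h | h
    · exact block_mul_block hle h
    · have := congrArg star (block_mul_block hle h)
      rwa [star_mul, (hWs i).isSelfAdjoint.star_eq, (hWs j).isSelfAdjoint.star_eq,
        star_zero] at this
  have hfam : OrthogonalFamily ℂ (fun k => (W k).range) fun k => (W k).range.subtypeₗᵢ := by
    rintro i j hij ⟨_, x, rfl⟩ ⟨_, y, rfl⟩
    exact inner_apply_eq_zero (hWs i).isSelfAdjoint (hWW i j hij) x y
  -- The blocks are orthogonal and the scalars bounded by 1, so Bessel's inequality gives strong
  -- convergence; boundedness of the limit is Banach–Steinhaus.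
  have hsum : ∀ x, Summable fun k => q k • W k x := by
    intro x
    have h1 : Summable fun k => ‖W k x‖ ^ 2 := by
      refine summable_of_sum_range_le (c := ‖x‖ ^ 2) (fun k => by positivity) fun n => ?_
      have h2 := sum_norm_sq_block hp hle n x
      have h3 : ‖p n x‖ ≤ ‖x‖ := by simpa using (p n).le_of_opNorm_le (hp n).norm_le x
      have h4 := pow_le_pow_left₀ (norm_nonneg _) h3 2
      have h5 : 0 ≤ ‖p 0 x‖ ^ 2 := by positivity
      linarith
    let f : ∀ k, (W k).range := fun k => ⟨q k • W k x, q k • x, by simp⟩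
    refine (hfam.summable_iff_norm_sq_summable f).2
      (h1.of_nonneg_of_le (fun k => by positivity) fun k => ?_)
    change ‖q k • W k x‖ ^ 2 ≤ _
    rw [norm_smul, mul_pow]
    exact mul_le_of_le_one_left (by positivity) (pow_le_one₀ (norm_nonneg _) (hq k))
  set g : ℕ → H →L[ℂ] H := fun n => ∑ k ∈ Finset.range n, q k • W k with hg
  have hgx : ∀ n x, g n x = ∑ k ∈ Finset.range n, q k • W k x := fun n x => by
    simp [hg]
  have hlim : Tendsto (fun n x => g n x) atTop (𝓝 fun x => ∑' k, q k • W k x) := by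
    rw [tendsto_pi_nhds]
    intro x
    simp only [hgx]
    exact (hsum x).hasSum.tendsto_sum_nat
  set T : H →L[ℂ] H := continuousLinearMapOfTendsto g hlim with hT
  have hTx : ∀ x, Tendsto (fun n => g n x) atTop (𝓝 (T x)) := fun x => tendsto_pi_nhds.1 hlim x
  refine ⟨T, fun B hB => ?_, fun k => ?_⟩
  · have hBg : ∀ n, Commute B (g n) := fun n =>
      Commute.sum_right _ _ _ fun k _ => ((hB (k + 1)).sub_right (hB k)).smul_right _
    ext x
    refine tendsto_nhds_unique ((B.continuous.tendsto _).comp (hTx x)) ?_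
    refine (hTx (B x)).congr fun n => ?_
    exact (DFunLike.congr_fun (hBg n).eq x).symm
  · ext x
    refine tendsto_nhds_unique (hTx (W k x)) (tendsto_const_nhds.congr' ?_)
    filter_upwards [eventually_gt_atTop k] with n hn
    rw [hgx, Finset.sum_eq_single_of_mem k (Finset.mem_range.2 hn)]
    · have := DFunLike.congr_fun (hWs k).isIdempotentElem.eq x
      change W k (W k x) = W k x at this
      rw [this]; rfl
    · intro j _ hj
      have : W j (W k x) = 0 := DFunLike.congr_fun (hWW j k hj) x
      rw [this, smul_zero]

/-- If an operator acts on nonzero blocks as scalars that accumulate at every point of the open unit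
disc, up to errors tending to zero, and has norm at most one, then its spectrum is connected. -/
lemma isPreconnected_spectrum_of_block (hp : ∀ k, IsStarProjection (p k))
    (hle : ∀ i j, i ≤ j → p i * p j = p i) (hne : ∀ k, 1 ≤ k → p (k + 1) - p k ≠ 0)
    {q : ℕ → ℂ} (hq : ∀ z : ℂ, ‖z‖ < 1 → ∀ δ : ℝ, 0 < δ → ∀ N : ℕ, ∃ k ≥ N, ‖q k - z‖ < δ)
    {A : H →L[ℂ] H} (hA : ‖A‖ ≤ 1)
    (hAq : ∀ k : ℕ, ‖A * (p (k + 1) - p k) - q k • (p (k + 1) - p k)‖ ≤ 1 / ((k : ℝ) + 1)) :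
    IsPreconnected (spectrum ℂ A) := by
  have hnt : Nontrivial (H →L[ℂ] H) := ⟨⟨_, _, hne 1 le_rfl⟩⟩
  have hH : Nontrivial H := by
    by_contra hH
    rw [not_nontrivial_iff_subsingleton] at hH
    exact hne 1 le_rfl (Subsingleton.elim _ _)
  have hWn : ∀ k, 1 ≤ k → ‖p (k + 1) - p k‖ = 1 := fun k hk => by
    have h1 := isStarProjection_block hp hle k
    have h2 : ‖p (k + 1) - p k‖ = ‖p (k + 1) - p k‖ * ‖p (k + 1) - p k‖ := by
      conv_lhs => rw [← h1.isIdempotentElem.eq]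
      exact h1.isSelfAdjoint.norm_mul_self.trans (sq _)
    have h3 : ‖p (k + 1) - p k‖ ≠ 0 := norm_ne_zero_iff.2 (hne k hk)
    exact (mul_right_cancel₀ h3 (by rw [← h2, one_mul])).symm
  -- A set between the open disc and its closure is connected. For z in the disc, a block with q_k
  -- near z has norm one and is nearly annihilated by z - A, so z - A has no bounded inverse.
  refine (convex_ball (0 : ℂ) 1).isPreconnected.subset_closure (fun z hz => ?_) ?_
  · rw [mem_ball_zero_iff] at hz
    rintro ⟨u, hu⟩
    have hC : 0 < ‖(↑u⁻¹ : H →L[ℂ] H)‖ := norm_pos_iff.2 (Units.ne_zero _)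
    set C := ‖(↑u⁻¹ : H →L[ℂ] H)‖
    obtain ⟨m, hm⟩ := exists_nat_one_div_lt (show 0 < 1 / (2 * C) by positivity)
    obtain ⟨k, hk, hkz⟩ := hq z hz (1 / (2 * C)) (by positivity) (max 1 m)
    set W := p (k + 1) - p k with hW
    have hW1 : ‖W‖ = 1 := hWn k ((le_max_left _ _).trans hk)
    have h1 : (u : H →L[ℂ] H) * W = -((A * W - q k • W) + (q k - z) • W) := by
      rw [hu, Algebra.algebraMap_eq_smul_one, sub_mul, smul_mul_assoc, one_mul]
      module
    have h2 : ‖(u : H →L[ℂ] H) * W‖ < 1 / C := by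
      rw [h1, norm_neg]
      have h3 : 1 / ((k : ℝ) + 1) ≤ 1 / ((m : ℝ) + 1) := by
        have : (m : ℝ) ≤ k := Nat.cast_le.2 ((le_max_right _ _).trans hk)
        exact one_div_le_one_div_of_le (by positivity) (by linarith)
      have h4 : ‖(q k - z) • W‖ < 1 / (2 * C) := by rwa [norm_smul, hW1, mul_one]
      have h5 : 1 / C = 1 / (2 * C) + 1 / (2 * C) := by field_simp; norm_num
      have := norm_add_le (A * W - q k • W) ((q k - z) • W)
      have := hAq k
      linarith
    have h3 : ‖W‖ ≤ C * ‖(u : H →L[ℂ] H) * W‖ := by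
      calc ‖W‖ = ‖(↑u⁻¹ : H →L[ℂ] H) * ((u : H →L[ℂ] H) * W)‖ := by
            rw [← mul_assoc, Units.inv_mul, one_mul]
        _ ≤ _ := norm_mul_le _ _
    rw [lt_div_iff₀ hC] at h2
    linarith
  · rw [closure_ball _ one_ne_zero]
    exact (spectrum.subset_closedBall_norm A).trans (Metric.closedBall_subset_closedBall hA)

end Blocks

/-! ### Central projections from ideal projections of bounded Φ, and the case of infinite supremum.
-/

variable {M : VonNeumannAlgebra H} {I : Submodule ℂ (H →L[ℂ] H)} {hI : IsTwoSidedIdeal M I}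
  {Φ : Seminorm ℂ I}

/-- The closed span of the ranges of the projections `E` in the ideal with `Φ E < t`. -/
def projectionSpan (Φ : Seminorm ℂ I) (t : ℝ) : Submodule ℂ H :=
  (Submodule.span ℂ {y | ∃ E : I, IsStarProjection (E : H →L[ℂ] H) ∧ Φ E < t ∧
    ∃ x, (E : H →L[ℂ] H) x = y}).topologicalClosure

instance (t : ℝ) : CompleteSpace (projectionSpan Φ t) :=
  (Submodule.isClosed_topologicalClosure _).completeSpace_coe

lemma apply_mem_projectionSpan {E : I} (hE : IsStarProjection (E : H →L[ℂ] H)) {t : ℝ}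
    (h : Φ E < t) (x : H) : (E : H →L[ℂ] H) x ∈ projectionSpan Φ t :=
  Submodule.le_topologicalClosure _ (Submodule.subset_span ⟨E, hE, h, x, rfl⟩)

lemma projectionSpan_le {t : ℝ} {K : Submodule ℂ H} (hK : IsClosed (K : Set H))
    (h : ∀ E : I, IsStarProjection (E : H →L[ℂ] H) → Φ E < t → ∀ x, (E : H →L[ℂ] H) x ∈ K) :
    projectionSpan Φ t ≤ K := by
  refine Submodule.topologicalClosure_minimal _ (Submodule.span_le.2 ?_) hK
  rintro _ ⟨E, hE, hEt, x, rfl⟩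
  exact h E hE hEt x

lemma projectionSpan_mono (Φ : Seminorm ℂ I) : Monotone (projectionSpan Φ) := fun _ _ hst =>
  projectionSpan_le (Submodule.isClosed_topologicalClosure _) fun _ hE hEt x =>
    apply_mem_projectionSpan hE (hEt.trans_le hst) x

lemma map_mem_projectionSpan {t : ℝ} {A : H →L[ℂ] H}
    (h : ∀ E : I, IsStarProjection (E : H →L[ℂ] H) → Φ E < t →
      ∀ x, A ((E : H →L[ℂ] H) x) ∈ projectionSpan Φ t) :
    ∀ y ∈ projectionSpan Φ t, A y ∈ projectionSpan Φ t := by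
  have hcl : IsClosed ((projectionSpan Φ t).comap (A : H →ₗ[ℂ] H) : Set H) :=
    (Submodule.isClosed_topologicalClosure _).preimage A.continuous
  exact projectionSpan_le hcl h

lemma commutant_map_mem_projectionSpan (hI : IsTwoSidedIdeal M I) {t : ℝ} {B : H →L[ℂ] H}
    (hB : B ∈ M.commutant) : ∀ y ∈ projectionSpan Φ t, B y ∈ projectionSpan Φ t := by
  refine map_mem_projectionSpan fun E hE hEt x => ?_
  have h1 := DFunLike.congr_fun
    (VonNeumannAlgebra.mem_commutant_iff.1 hB (E : H →L[ℂ] H) (hI.subset _ E.2)) x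
  change (E : H →L[ℂ] H) (B x) = B ((E : H →L[ℂ] H) x) at h1
  rw [← h1]
  exact apply_mem_projectionSpan hE hEt _

/-- For unitary U in M, U maps the range of E onto that of UEU*, a projection with the same Φ.
Unitaries span M. -/
lemma map_mem_projectionSpan_of_mem (hinv : IsUnitarilyInvariant hI Φ) {t : ℝ} {A : H →L[ℂ] H}
    (hA : A ∈ M) : ∀ y ∈ projectionSpan Φ t, A y ∈ projectionSpan Φ t := by
  obtain ⟨u, c, huM, hu, rfl, -⟩ := exists_sum_four_unitary M hA
  refine map_mem_projectionSpan fun E hE hEt x => ?_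
  have hmem : ∀ i, u i ((E : H →L[ℂ] H) x) ∈ projectionSpan Φ t := by
    intro i
    have h1 : star (u i) * u i = 1 := (Unitary.mem_iff.1 (hu i)).1
    have hstar : star (u i) ∈ unitary (H →L[ℂ] H) := Unitary.star_mem (hu i)
    have hΦ := hinv _ _ (huM i) (star_mem (huM i)) (hu i) hstar E
    have hproj : IsStarProjection (u i * (E : H →L[ℂ] H) * star (u i)) := by
      refine ⟨?_, hE.isSelfAdjoint.conjugate (u i)⟩
      calc u i * (E : H →L[ℂ] H) * star (u i) * (u i * E * star (u i))
          = u i * E * (star (u i) * u i) * E * star (u i) := by simp only [mul_assoc]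
        _ = u i * (E * E) * star (u i) := by rw [h1, mul_one, mul_assoc (u i)]
        _ = _ := by rw [hE.isIdempotentElem.eq]
    have h2 := apply_mem_projectionSpan (Φ := Φ) (t := t) (E := ⟨_, hI.mul_mem_right _
      (star_mem (huM i)) _ (hI.mul_mem_left _ (huM i) _ E.2)⟩) hproj (hΦ.trans_lt hEt) (u i x)
    have h3 : (u i * (E : H →L[ℂ] H) * star (u i)) (u i x) = u i ((E : H →L[ℂ] H) x) := by
      have : u i * (E : H →L[ℂ] H) * star (u i) * u i = u i * E := by
        rw [mul_assoc, h1, mul_one]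
      exact DFunLike.congr_fun this x
    exact h3 ▸ h2
  have h4 : (∑ i, c i • u i) ((E : H →L[ℂ] H) x) = ∑ i, c i • u i ((E : H →L[ℂ] H) x) := by
    simp
  rw [h4]
  exact Submodule.sum_mem _ fun i _ => Submodule.smul_mem _ _ (hmem i)

lemma starProjection_projectionSpan_mem (hI : IsTwoSidedIdeal M I) (t : ℝ) :
    (projectionSpan Φ t).starProjection ∈ M :=
  starProjection_mem_of_invariant M _ fun _ hB => commutant_map_mem_projectionSpan hI hB

/-- Invariance under M places the projection in the commutant. This is why perturbations from the
ideal stay block diagonal. -/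
lemma commute_starProjection_projectionSpan (hinv : IsUnitarilyInvariant hI Φ) (t : ℝ)
    {A : H →L[ℂ] H} (hA : A ∈ M) : Commute A (projectionSpan Φ t).starProjection := by
  have h : (projectionSpan Φ t).starProjection ∈ M.commutant :=
    starProjection_mem_of_invariant M.commutant _ fun B hB => by
      rw [VonNeumannAlgebra.commutant_commutant] at hB
      exact map_mem_projectionSpan_of_mem hinv hB
  exact VonNeumannAlgebra.mem_commutant_iff.1 h A hA

lemma mul_starProjection_projectionSpan_of_lt {E : I} (hE : IsStarProjection (E : H →L[ℂ] H))
    {t : ℝ} (h : Φ E < t) : (E : H →L[ℂ] H) * (projectionSpan Φ t).starProjection = E := by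
  have h1 : (projectionSpan Φ t).starProjection * (E : H →L[ℂ] H) = E := by
    ext x
    exact Submodule.starProjection_eq_self_iff.2 (apply_mem_projectionSpan hE h x)
  have h2 := congrArg star h1
  rwa [star_mul, hE.isSelfAdjoint.star_eq, isStarProjection_starProjection.isSelfAdjoint.star_eq]
    at h2

/-- On the orthogonal complement of `projectionSpan Φ t`, the norm `Φ` dominates a multiple of the
operator norm. -/
lemma mul_norm_le_of_mul_starProjection_eq_zero (hinv : IsUnitarilyInvariant hI Φ) {t : ℝ} (X : I)
    (h : (X : H →L[ℂ] H) * (projectionSpan Φ t).starProjection = 0) :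
    t * ‖(X : H →L[ℂ] H)‖ ≤ 4 * Φ X := by
  by_cases hX : X = 0
  · simp [hX]
  obtain ⟨E, hE, hE0, hEX, C, -, hC⟩ := exists_projection_of_ne_zero hinv X hX
  have hEp : (E : H →L[ℂ] H) * (projectionSpan Φ t).starProjection = 0 := by
    rw [hC, mul_assoc, h, mul_zero]
  have ht : t ≤ Φ E := by
    by_contra! hlt
    rw [mul_starProjection_projectionSpan_of_lt hE hlt] at hEp
    exact hE0 (Subtype.ext hEp)
  exact (mul_le_mul_of_nonneg_right ht (norm_nonneg _)).trans hEX

/-- Choose a nonzero P in M all of whose nonzero ideal subprojections have Φ > 8t. Every ideal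
projection E with Φ(E) < t then satisfies EP = 0, so the span lies in the kernel of P. -/
lemma projectionSpan_ne_top (hinv : IsUnitarilyInvariant hI Φ) (hc : cPhi M Φ = ∞) (t : ℝ) :
    projectionSpan Φ t ≠ ⊤ := by
  wlog ht : 0 < t generalizing t
  · intro htop
    refine this 1 one_pos (top_unique ?_)
    rw [← htop]
    exact projectionSpan_mono Φ (by linarith)
  have hlt : ENNReal.ofReal (8 * t) < cPhi M Φ := hc ▸ ENNReal.ofReal_lt_top
  rw [cPhi, lt_iSup_iff] at hlt
  obtain ⟨⟨P, hPM, hP, hP0⟩, hPt⟩ := hlt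
  have hker : projectionSpan Φ t ≤ P.ker := by
    refine projectionSpan_le P.isClosed_ker fun E hE hEt x => ?_
    set Y : I := ⟨E * P, hI.mul_mem_right P hPM E E.2⟩ with hY
    have hY0 : Y = 0 := by
      by_contra hYne
      have hYn : 0 < ‖(Y : H →L[ℂ] H)‖ := norm_pos_iff.2 fun h => hYne (Subtype.ext h)
      obtain ⟨F, hF, hF0, hFY, C, -, hC⟩ := exists_projection_of_ne_zero hinv Y hYne
      have hFP : (F : H →L[ℂ] H) ≤ P := by
        rw [hF.le_iff_mul_eq_left hP, hC, hY, mul_assoc, mul_assoc, hP.isIdempotentElem.eq]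
      have h1 : ENNReal.ofReal (8 * t) < ENNReal.ofReal (Φ F) :=
        hPt.trans_le (iInf_le (fun E : {E : I // IsStarProjection (E : H →L[ℂ] H) ∧ E ≠ 0 ∧
          (E : H →L[ℂ] H) ≤ P} => ENNReal.ofReal (Φ E)) ⟨F, hF, hF0, hFP⟩)
      have h2 : 8 * t < Φ F := (ENNReal.ofReal_lt_ofReal_iff_of_nonneg (by positivity)).1 h1
      -- Reading Y as E·Y gives Φ(Y) ≤ 2‖Y‖Φ(E). The factor ‖Y‖ cancels against Φ(F)‖Y‖ ≤ 4Φ(Y),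
      -- leaving Φ(F) ≤ 8Φ(E) < 8t.
      have h3 := apply_mul_right_le hinv (hI.subset _ Y.2) E
      have h4 : (⟨E * Y, hI.mul_mem_right _ (hI.subset _ Y.2) E E.2⟩ : I) = Y := by
        apply Subtype.ext
        change (E : H →L[ℂ] H) * (E * P) = E * P
        rw [← mul_assoc, hE.isIdempotentElem.eq]
      rw [h4] at h3
      nlinarith
    have hEP : (E : H →L[ℂ] H) * P = 0 := congrArg Subtype.val hY0
    have hPE : P * (E : H →L[ℂ] H) = 0 := by
      have := congrArg star hEP
      rwa [star_mul, hE.isSelfAdjoint.star_eq, hP.isSelfAdjoint.star_eq, star_zero] at this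
    exact DFunLike.congr_fun hPE x
  intro htop
  rw [htop] at hker
  exact hP0 (by ext x; exact hker (Submodule.mem_top : x ∈ ⊤))

/-- Let Z project onto the orthogonal complement. For X in the ideal, XZ vanishes on every span, so
n‖XZ‖ ≤ 4Φ(XZ) for all n and XZ = 0. Approximating 1 weakly by the ideal gives ⟨Zx, Zx⟩ = 0. -/
lemma topologicalClosure_iSup_projectionSpan (hinv : IsUnitarilyInvariant hI Φ)
    (hdense : IsWeakOperatorDense M I) :
    (⨆ n : ℕ, projectionSpan Φ (n : ℝ)).topologicalClosure = ⊤ := by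
  set K := (⨆ n : ℕ, projectionSpan Φ (n : ℝ)).topologicalClosure with hK
  have hKcl : IsClosed (K : Set H) := Submodule.isClosed_topologicalClosure _
  have : CompleteSpace K := hKcl.completeSpace_coe
  have hle : ∀ n : ℕ, projectionSpan Φ (n : ℝ) ≤ K := fun n =>
    (le_iSup (fun n : ℕ => projectionSpan Φ (n : ℝ)) n).trans (Submodule.le_topologicalClosure _)
  have hpM : K.starProjection ∈ M := by
    refine starProjection_mem_of_invariant M K fun B hB => ?_
    have hcl : IsClosed (K.comap (B : H →ₗ[ℂ] H) : Set H) := hKcl.preimage B.continuous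
    have hinvt : K ≤ K.comap (B : H →ₗ[ℂ] H) :=
      Submodule.topologicalClosure_minimal _ (iSup_le fun n y hy =>
        hle n (commutant_map_mem_projectionSpan hI hB y hy)) hcl
    exact hinvt
  set Z : H →L[ℂ] H := 1 - K.starProjection with hZ
  have hZM : Z ∈ M := sub_mem (one_mem M) hpM
  have hZp : ∀ n : ℕ, Z * (projectionSpan Φ (n : ℝ)).starProjection = 0 := by
    intro n
    ext x
    change (projectionSpan Φ (n : ℝ)).starProjection x
      - K.starProjection ((projectionSpan Φ (n : ℝ)).starProjection x) = 0
    rw [sub_eq_zero, eq_comm, Submodule.starProjection_eq_self_iff]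
    exact hle n (Submodule.starProjection_apply_mem _ x)
  have hXZ : ∀ X ∈ I, X * Z = 0 := by
    intro X hX
    by_contra hne
    have hpos : 0 < ‖X * Z‖ := norm_pos_iff.2 hne
    obtain ⟨n, hn⟩ := exists_nat_gt (4 * Φ ⟨X * Z, hI.mul_mem_right Z hZM X hX⟩ / ‖X * Z‖)
    rw [div_lt_iff₀ hpos] at hn
    have := mul_norm_le_of_mul_starProjection_eq_zero hinv (t := n)
      ⟨X * Z, hI.mul_mem_right Z hZM X hX⟩ (by
        change X * Z * _ = 0
        rw [mul_assoc, hZp, mul_zero])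
    exact absurd this (not_le.2 hn)
  have hZ0 : ∀ x, Z x = 0 := by
    intro x
    have hcont : Continuous fun A : ContinuousLinearMapWOT (RingHom.id ℂ) H H =>
        inner ℂ (Z x) (A (Z x)) :=
      ContinuousLinearMapWOT.continuous_dual_apply (Z x) (innerSL ℂ (Z x))
    have hsub : closure (ContinuousLinearMapWOT.ofCLM '' (I : Set (H →L[ℂ] H))) ⊆
        {A : ContinuousLinearMapWOT (RingHom.id ℂ) H H | inner ℂ (Z x) (A (Z x)) = 0} := by
      refine closure_minimal ?_ (isClosed_eq hcont continuous_const)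
      rintro _ ⟨X, hX, rfl⟩
      have : X (Z x) = 0 := DFunLike.congr_fun (hXZ X hX) x
      change inner ℂ (Z x) (X (Z x)) = 0
      rw [this, inner_zero_right]
    have h1 := hsub (hdense 1 (one_mem M))
    exact inner_self_eq_zero.1 h1
  refine top_unique fun x _ => ?_
  have h1 : x - K.starProjection x = 0 := hZ0 x
  exact Submodule.starProjection_eq_self_iff.1 (sub_eq_zero.1 h1).symm

theorem exists_forall_isPreconnected_of_cPhi_eq_top (hinv : IsUnitarilyInvariant hI Φ)
    (hdense : IsWeakOperatorDense M I) (hdom : IsNormDominating Φ) (hc : cPhi M Φ = ∞) :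
    ∃ T ∈ M, ∃ ε : ℝ, 0 < ε ∧
      ∀ X : I, Φ X < ε → IsPreconnected (spectrum ℂ (T + (X : H →L[ℂ] H))) := by
  set L : ℕ → Submodule ℂ H := fun n => projectionSpan Φ (n : ℝ) with hL
  have hLmono : Monotone L := fun m n h => projectionSpan_mono Φ (Nat.cast_le.2 h)
  have htop := topologicalClosure_iSup_projectionSpan hinv hdense
  have hfreq : ∃ᶠ n in atTop, L n ≠ L (n + 1) := by
    rw [frequently_atTop]
    by_contra! hcon
    obtain ⟨N, hN⟩ := hcon
    have hconst : ∀ n ≥ N, L n = L N := by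
      intro n hn
      induction n, hn using Nat.le_induction with
      | base => rfl
      | succ n hn ih => rw [← hN n hn, ih]
    have hle : (⨆ n, L n).topologicalClosure ≤ L N := by
      refine Submodule.topologicalClosure_minimal _ (iSup_le fun n => ?_)
        (Submodule.isClosed_topologicalClosure _)
      rcases le_total n N with h | h
      · exact hLmono h
      · exact (hconst n h).le
    exact projectionSpan_ne_top hinv hc N (top_unique (htop ▸ hle))
  obtain ⟨φ, hφ, hφL⟩ := extraction_of_frequently_atTop hfreq
  -- Prepending 0 makes the blocks exhaust the space. Block 0 may vanish, so nonvanishing is claimed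
  -- only from k = 1 on.
  let p : ℕ → H →L[ℂ] H := fun k => Nat.casesOn k 0 fun j => (L (φ j)).starProjection
  have hp0 : p 0 = 0 := rfl
  have hps : ∀ k, p (k + 1) = (L (φ k)).starProjection := fun k => rfl
  have hp : ∀ k, IsStarProjection (p k) := by
    rintro (_ | k)
    · exact .zero _
    · exact isStarProjection_starProjection
  have hpM : ∀ k, p k ∈ M := by
    rintro (_ | k)
    · exact zero_mem M
    · exact starProjection_projectionSpan_mem hI _
  have hpc : ∀ k, ∀ A ∈ M, Commute A (p k) := by
    rintro (_ | k) A hA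
    · exact Commute.zero_right A
    · exact commute_starProjection_projectionSpan hinv _ hA
  have hle : ∀ i j, i ≤ j → p i * p j = p i := by
    rintro (_ | i) (_ | j) hij
    · simp [hp0]
    · simp [hp0]
    · omega
    · exact Submodule.starProjection_comp_starProjection_of_le
        (hLmono (hφ.monotone (Nat.le_of_succ_le_succ hij)))
  have hlim : ∀ x, Tendsto (fun k => p k x) atTop (𝓝 x) := by
    intro x
    rw [← tendsto_add_atTop_iff_nat 1]
    exact (Submodule.starProjection_tendsto_self L hLmono x htop.ge).comp hφ.tendsto_atTop
  have hne : ∀ k, 1 ≤ k → p (k + 1) - p k ≠ 0 := by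
    rintro (_ | k) hk h
    · omega
    · rw [hps, hps, sub_eq_zero, Submodule.starProjection_inj] at h
      refine hφL k (le_antisymm (hLmono (Nat.le_succ _)) ?_)
      rw [← h]
      exact hLmono (hφ (Nat.lt_succ_self k))
  obtain ⟨q, hq1, hq⟩ := exists_frequently_near_seq
  have hq2 : ∀ k, ‖q k‖ ≤ 1 := fun k => (hq1 k).trans (by
    have : (0 : ℝ) ≤ 1 / ((k : ℝ) + 1) := by positivity
    linarith)
  obtain ⟨T, hTc, hTq⟩ := exists_block_scalar hp hle q hq2
  have hTM : T ∈ M := mem_of_commute_commutant M fun B hB => (hTc B fun k =>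
    (VonNeumannAlgebra.mem_commutant_iff.1 hB (p k) (hpM k)).symm).eq
  -- For k = j + 1 ≥ 2 this yields Φ(XW_k) ≤ 1/16, hence ‖XW_k‖ ≤ 1/(4j) ≤ 1/(k+1). For k < 2, where
  -- the bound from the spans may be void, ‖X‖ ≤ Φ(X) suffices.
  refine ⟨T, hTM, 1 / 32, by norm_num, fun X hX => ?_⟩
  have hWM : ∀ k, p (k + 1) - p k ∈ M := fun k => sub_mem (hpM (k + 1)) (hpM k)
  have hWn : ∀ k, ‖p (k + 1) - p k‖ ≤ 1 := fun k => (isStarProjection_block hp hle k).norm_le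
  have hXsmall : ∀ k : ℕ, ‖(X : H →L[ℂ] H) * (p (k + 1) - p k)‖ ≤ 1 / ((k : ℝ) + 1) := by
    intro k
    have hXn : ‖(X : H →L[ℂ] H) * (p (k + 1) - p k)‖ ≤ 1 / 32 := by
      calc _ ≤ ‖(X : H →L[ℂ] H)‖ * ‖p (k + 1) - p k‖ := norm_mul_le _ _
        _ ≤ ‖(X : H →L[ℂ] H)‖ * 1 := by gcongr; exact hWn k
        _ ≤ 1 / 32 := by linarith [hdom X]
    rcases Nat.lt_or_ge k 2 with hk | hk
    · refine hXn.trans ?_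
      rw [div_le_div_iff₀ (by norm_num) (by positivity)]
      have : (k : ℝ) < 2 := by exact_mod_cast hk
      linarith
    · obtain ⟨j, rfl⟩ : ∃ j, k = j + 1 := ⟨k - 1, by omega⟩
      set Y : I := ⟨X * (p (j + 1 + 1) - p (j + 1)), hI.mul_mem_right _ (hWM _) X X.2⟩ with hY
      have h1 : (φ j : ℝ) * ‖(Y : H →L[ℂ] H)‖ ≤ 4 * Φ Y := by
        refine mul_norm_le_of_mul_starProjection_eq_zero hinv Y ?_
        change X * (p (j + 1 + 1) - p (j + 1)) * p (j + 1) = 0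
        rw [mul_assoc, sub_mul, mul_eq_right_of_le hp hle (Nat.le_succ _),
          (hp (j + 1)).isIdempotentElem.eq, sub_self, mul_zero]
      have h2 : Φ Y ≤ 2 * ‖p (j + 1 + 1) - p (j + 1)‖ * Φ X := apply_mul_right_le hinv (hWM _) X
      have h3 : Φ Y ≤ 1 / 16 := by
        have := hWn (j + 1)
        have h0 : 0 ≤ Φ X := apply_nonneg _ _
        nlinarith
      have h4 : (j : ℝ) ≤ φ j := Nat.cast_le.2 (hφ.id_le j)
      have h5 : (1 : ℝ) ≤ j := by exact_mod_cast (by omega : 1 ≤ j)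
      have h6 : 0 ≤ ‖(Y : H →L[ℂ] H)‖ := norm_nonneg _
      change ‖(Y : H →L[ℂ] H)‖ ≤ _
      rw [le_div_iff₀ (by positivity)]
      push_cast
      nlinarith
  have hblock : ∀ k, (T + (X : H →L[ℂ] H)) * (p (k + 1) - p k) - q k • (p (k + 1) - p k)
      = X * (p (k + 1) - p k) := fun k => by rw [add_mul, hTq, add_sub_cancel_left]
  refine isPreconnected_spectrum_of_block hp hle hne hq ?_ fun k => ?_
  · refine norm_le_one_of_block hp hle hp0 hlim
      (fun k => hpc k _ (add_mem hTM (hI.subset _ X.2))) fun k => ?_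
    rw [add_mul, hTq]
    have h1 : ‖q k • (p (k + 1) - p k)‖ ≤ 1 - 1 / ((k : ℝ) + 1) := by
      rw [norm_smul]
      calc _ ≤ ‖q k‖ * 1 := by gcongr; exact hWn k
        _ ≤ _ := by rw [mul_one]; exact hq1 k
    linarith [norm_add_le (q k • (p (k + 1) - p k)) ((X : H →L[ℂ] H) * (p (k + 1) - p k)),
      hXsmall k]
  · rw [hblock]
    exact hXsmall k

end SupInf

end

theorem theorem1p1 {H : Type*} [NormedAddCommGroup H] [InnerProductSpace ℂ H] [CompleteSpace H]
    (M : VonNeumannAlgebra H) (hM : 1 < Module.rank ℂ M.toStarSubalgebra)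
    (I : Submodule ℂ (H →L[ℂ] H)) (hI : SupInf.IsTwoSidedIdeal M I)
    (hdense : SupInf.IsWeakOperatorDense M I)
    (Φ : Seminorm ℂ I) (hnorm : SupInf.IsNorm Φ)
    (hinv : SupInf.IsUnitarilyInvariant hI Φ) (hdom : SupInf.IsNormDominating Φ) :
    SupInf.cPhi M Φ < ∞ ↔
      ∀ T ∈ M, ∀ ε : ℝ, 0 < ε →
        ∃ X : I, Φ X < ε ∧ ¬ IsPreconnected (spectrum ℂ (T + (X : H →L[ℂ] H))) := by
  refine ⟨fun hc T hT ε hε => SupInf.exists_not_isPreconnected_of_cPhi_lt_top hM hinv hc hT hε,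
    fun h => ?_⟩
  rw [lt_top_iff_ne_top]
  intro hc
  obtain ⟨T, hT, ε, hε, hpre⟩ :=
    SupInf.exists_forall_isPreconnected_of_cPhi_eq_top hinv hdense hdom hc
  obtain ⟨X, hX, hnot⟩ := h T hT ε hε
  exact hnot (hpre X hX)
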